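/- Let $d\ge 1$, let $\mathbb{S}^{d}=\{x\in\mathbb{R}^{d+1}:\|x\|=1\}$ with surface area measure $\sigma_d$ ($\sigma_0$ is the counting measure on $\mathbb{S}^0=\{-1,1\}$), and let $\omega_d=2\pi^{(d+1)/2}/\Gamma((d+1)/2)$. $\mathrm{Unif}(\mathbb{S}^{d})$ has density $1/\omega_d$ with respect to $\sigma_d$. For $k\ge 1$ let $C_k^{(d-1)/2}$ be the Gegenbauer polynomial of degree $k$ and index $(d-1)/2$ if $d\ge2$, and $C_k^{0}:=T_k$, the Chebyshev polynomial of the first kind, if $d=1$. Put $\tilde C_k(x)=C_k^{(d-1)/2}(x)/C_k^{(d-1)/2}(1)$. For $\mu\in\mathbb{S}^{d}$ and $\rho\in[-1,1]$, the spherical cardioid distribution $\mathrm{C}_k(\mu,\rho)$ on $\mathbb{S}^d$ has density $x\mapsto \omega_d^{-1}\{1+\rho\,\tilde C_k(x^\top\mu)\}$ with respect to $\sigma_d$. Let $k$ be odd and let $B_\mu$ be any $(d+1)\times d$ real matrix with $B_\mu^\top B_\mu=I_d$ and $\mu^\top B_\mu=0$. Consider the following rejection-free algorithm. 1. Simulate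 $U\sim\mathrm{Unif}(\mathbb{S}^{d})$ and set $R=|U^\top e_1|$, where $e_1=(1,0,\ldots,0)^\top$. 2. Simulate $S\in\{-1,1\}$ with $\mathbb{P}(S=1\mid R)=\{1+\rho\,\tilde C_k(R)\}/2$ and set $T=SR$. 3. Simulate $\Xi\sim\mathrm{Unif}(\mathbb{S}^{d-1})$ independent of $(R,S)$. 4. Return $X=T\mu+\sqrt{1-T^2}\,B_\mu\Xi$. Then the algorithm is well defined, that is, $0\le\{1+\rho\,\tilde C_k(r)\}/2\le 1$ for all $r\in[0,1]$, and its output is a random vector $X$ with values in $\mathbb{S}^d$ that is distributed exactly as $\mathrm{C}_k(\mu,\rho)$. -/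

import Mathlib

open MeasureTheory ProbabilityTheory Matrix

noncomputable section

namespace SphericalCardioid

/-- The unit sphere of `ℝⁿ` (with the Euclidean norm); `𝕊ᵈ` is `UnitSphere (d + 1)`. -/
abbrev UnitSphere (n : ℕ) : Type := Metric.sphere (0 : EuclideanSpace ℝ (Fin n)) 1

/-- The surface area measure on the unit sphere of `ℝⁿ`
(for `n = 1`, the counting measure on the two points `±1`). -/
def surfaceMeasure (n : ℕ) : Measure (UnitSphere n) :=
  (volume : Measure (EuclideanSpace ℝ (Fin n))).toSphere

/-- The surface area `2 π ^ (n / 2) / Γ (n / 2)` of the unit sphere of `ℝⁿ`. -/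
def sphereArea (n : ℕ) : ℝ :=
  2 * Real.pi ^ ((n : ℝ) / 2) / Real.Gamma ((n : ℝ) / 2)

/-- The uniform distribution on the unit sphere of `ℝⁿ`: constant density with respect to the
surface area measure. -/
def uniformSphere (n : ℕ) : Measure (UnitSphere n) :=
  (surfaceMeasure n).withDensity fun _ => ENNReal.ofReal (1 / sphereArea n)

/-- The Gegenbauer polynomials `C_k^l`, through their three-term recurrence
`(k + 2) C_{k+2}^l = 2 (k + 1 + l) x C_{k+1}^l - (k + 2 l) C_k^l`. -/
def gegenbauer (l : ℝ) : ℕ → Polynomial ℝ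
  | 0 => 1
  | 1 => Polynomial.C (2 * l) * Polynomial.X
  | k + 2 =>
      Polynomial.C (2 * (k + 1 + l) / (k + 2)) * Polynomial.X * gegenbauer l (k + 1)
        - Polynomial.C ((k + 2 * l) / (k + 2)) * gegenbauer l k

/-- The zonal polynomial `C_k^{(d-1)/2}` on `𝕊ᵈ`, with the convention `C_k^0 = T_k`
(Chebyshev polynomial of the first kind) for `d = 1`. -/
def zonalPoly (d k : ℕ) : Polynomial ℝ :=
  if d = 1 then Polynomial.Chebyshev.T ℝ k else gegenbauer (((d : ℝ) - 1) / 2) k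

/-- The normalized polynomial `C_k^{(d-1)/2}(x) / C_k^{(d-1)/2}(1)`. -/
def normalizedZonal (d k : ℕ) (x : ℝ) : ℝ :=
  (zonalPoly d k).eval x / (zonalPoly d k).eval 1

/-- The density of the spherical cardioid distribution of order `k` on `𝕊ᵈ`. -/
def cardioidDensity (d k : ℕ) (μ : UnitSphere (d + 1)) (ρ : ℝ) (x : UnitSphere (d + 1)) : ℝ :=
  1 / sphereArea (d + 1) *
    (1 + ρ * normalizedZonal d k
      (inner ℝ (x : EuclideanSpace ℝ (Fin (d + 1))) (μ : EuclideanSpace ℝ (Fin (d + 1)))))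

/-- The spherical cardioid distribution of order `k` on `𝕊ᵈ` with location `μ` and
concentration `ρ`. -/
def cardioid (d k : ℕ) (μ : UnitSphere (d + 1)) (ρ : ℝ) : Measure (UnitSphere (d + 1)) :=
  (surfaceMeasure (d + 1)).withDensity fun x => ENNReal.ofReal (cardioidDensity d k μ ρ x)

/-- `B` is a semi-orthogonal `(d + 1) × d` matrix with `μᵀ B = 0`. -/
def IsTangentFrame {d : ℕ} (μ : UnitSphere (d + 1)) (B : Matrix (Fin (d + 1)) (Fin d) ℝ) : Prop :=
  Bᵀ * B = 1 ∧ (μ : EuclideanSpace ℝ (Fin (d + 1))).ofLp ᵥ* B = 0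

variable {Ω : Type*}

/-- The variable `R = |Uᵀ e₁|`. -/
def radius {d : ℕ} (U : Ω → UnitSphere (d + 1)) (ω : Ω) : ℝ :=
  |inner ℝ (U ω : EuclideanSpace ℝ (Fin (d + 1))) (EuclideanSpace.single 0 1)|

/-- The probability of the sign `+1` when `R = r`. -/
def plusProb (d k : ℕ) (ρ r : ℝ) : ℝ :=
  (1 + ρ * normalizedZonal d k r) / 2

/-- `U`, `S`, `Ξ` are the random variables simulated in one run of the rejection-free algorithm:
`U` is uniform on `𝕊ᵈ`, the sign `S` has `P(S = 1 | R) = (1 + ρ C̃_k(R)) / 2`, and `Ξ` is uniform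
on `𝕊^{d-1}` and independent of `(R, S)`. -/
structure IsRun [MeasurableSpace Ω] (P : Measure Ω) (d k : ℕ) (ρ : ℝ)
    (U : Ω → UnitSphere (d + 1)) (S : Ω → ℝ) (Ξ : Ω → UnitSphere d) : Prop where
  measurable_U : Measurable U
  measurable_S : Measurable S
  measurable_Ξ : Measurable Ξ
  law_U : HasLaw U (uniformSphere (d + 1)) P
  sign_S : ∀ ω, S ω = 1 ∨ S ω = -1
  condProb_S : P⟦S ⁻¹' {1} | MeasurableSpace.comap (radius U) inferInstance⟧
    =ᵐ[P] fun ω => plusProb d k ρ (radius U ω)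
  law_Ξ : HasLaw Ξ (uniformSphere d) P
  indep : IndepFun (fun ω => (radius U ω, S ω)) Ξ P

/-- The output `T μ + √(1 - T²) B Ξ` with `T = S R`. -/
def output {d : ℕ} (μ : UnitSphere (d + 1)) (B : Matrix (Fin (d + 1)) (Fin d) ℝ)
    (U : Ω → UnitSphere (d + 1)) (S : Ω → ℝ) (Ξ : Ω → UnitSphere d) (ω : Ω) :
    EuclideanSpace ℝ (Fin (d + 1)) :=
  (S ω * radius U ω) • (μ : EuclideanSpace ℝ (Fin (d + 1)))
    + √(1 - (S ω * radius U ω) ^ 2) • Matrix.toEuclideanLin B (Ξ ω : EuclideanSpace ℝ (Fin d))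

end SphericalCardioid

end

/-! The sign probabilities are legitimate because `|C̃_k| ≤ 1` on `[-1, 1]`. For `d = 1` this is the
Chebyshev bound. For `d ≥ 2` write `x = cos θ`; the generating function `(1 - 2xt + t²)^(-l)`
factors as `(1 - e^{iθ}t)^(-l) (1 - e^{-iθ}t)^(-l)`, and for `l > 0` the factors have positive
coefficients times unimodular powers, so each coefficient of the product has its largest modulus at
`θ = 0` (`abs_gegenbauer_eval_le`).

For the law, `C̃_k` is odd, so given `R = r` the signs `±1` have probabilities `(1 + ρ C̃_k(±r)) /
2`. Since `Uᵀe₁` is symmetric, `T = S R` then has density `1 + ρ C̃_k` with respect to the law of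
`Uᵀe₁`, which by rotation invariance is that of `Uᵀμ` (`lintegral_signed_radius`).

The cardioid density depends on `x` only through `xᵀμ`. It remains that, under the uniform law, the
tangential direction is uniform and independent of `xᵀμ` (`lintegral_uniformSphere_tangentNormal`).
This is deduced from Lebesgue measure, without computing the density of `xᵀμ`: extend the integrand
radially to the unit ball, split off the line through `μ`, and use that in its complement the
direction is uniform and independent of the norm (`lintegral_norm_direction`). -/

namespace SphericalCardioid

/-! ### Gegenbauer polynomials: generating function and maximum at `1`. -/

/-- The coefficient of `t ^ i` in `(1 - t) ^ (-l)`. -/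
noncomputable def negBinomCoeff (l : ℝ) (i : ℕ) : ℝ :=
  ∏ j ∈ Finset.range i, (l + j) / (j + 1)

lemma negBinomCoeff_zero (l : ℝ) : negBinomCoeff l 0 = 1 := by
  simp [negBinomCoeff]

lemma negBinomCoeff_succ (l : ℝ) (i : ℕ) :
    negBinomCoeff l (i + 1) * (i + 1) = (l + i) * negBinomCoeff l i := by
  have : (i : ℝ) + 1 ≠ 0 := by positivity
  rw [negBinomCoeff, Finset.prod_range_succ, negBinomCoeff]
  field_simp

lemma negBinomCoeff_pos {l : ℝ} (hl : 0 < l) (i : ℕ) : 0 < negBinomCoeff l i :=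
  Finset.prod_pos fun _ _ => by positivity

/-- The power series `(1 - z t) ^ (-l)` in `t`. -/
noncomputable def negBinomSeries (l : ℝ) (z : ℂ) : PowerSeries ℂ :=
  PowerSeries.mk fun i => (negBinomCoeff l i : ℂ) * z ^ i

lemma coeff_X_mul_derivative (f : PowerSeries ℂ) (n : ℕ) :
    PowerSeries.coeff n (PowerSeries.X * PowerSeries.derivative ℂ f)
      = n * PowerSeries.coeff n f := by
  cases n with
  | zero => simp
  | succ n => rw [PowerSeries.coeff_succ_X_mul, PowerSeries.coeff_derivative]; push_cast; ring

lemma derivative_negBinomSeries (l : ℝ) (z : ℂ) :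
    (1 - PowerSeries.C z * PowerSeries.X) * PowerSeries.derivative ℂ (negBinomSeries l z)
      = PowerSeries.C (l * z) * negBinomSeries l z := by
  ext n
  rw [sub_mul, one_mul, mul_assoc, map_sub, PowerSeries.coeff_C_mul, PowerSeries.coeff_C_mul,
    coeff_X_mul_derivative, PowerSeries.coeff_derivative]
  simp only [negBinomSeries, PowerSeries.coeff_mk]
  have h : (negBinomCoeff l (n + 1) : ℂ) * (n + 1) = (l + n) * negBinomCoeff l n := by
    exact_mod_cast negBinomCoeff_succ l n
  linear_combination z ^ (n + 1) * h

/-- The logarithmic derivatives `lz/(1 - zt)` and `lw/(1 - wt)` add up, and `(1 - zt)(1 - wt) = 1 -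
2xt + t²`. -/
lemma derivative_negBinomSeries_mul (l : ℝ) {x z w : ℂ} (h1 : z * w = 1) (h2 : z + w = 2 * x) :
    (1 - PowerSeries.C (2 * x) * PowerSeries.X + PowerSeries.X * PowerSeries.X) *
        PowerSeries.derivative ℂ (negBinomSeries l z * negBinomSeries l w)
      = PowerSeries.C (2 * (l : ℂ)) * (PowerSeries.C x - PowerSeries.X) *
        (negBinomSeries l z * negBinomSeries l w) := by
  have hz := derivative_negBinomSeries l z
  have hw := derivative_negBinomSeries l w
  have h1' : (PowerSeries.C z * PowerSeries.C w : PowerSeries ℂ) = 1 := by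
    rw [← map_mul, h1, map_one]
  have h2' : (PowerSeries.C z + PowerSeries.C w : PowerSeries ℂ) = 2 * PowerSeries.C x := by
    rw [← map_add, h2, map_mul, map_ofNat]
  rw [Derivation.leibniz, smul_eq_mul, smul_eq_mul]
  simp only [map_mul, map_ofNat] at hz hw ⊢
  set A := negBinomSeries l z
  set B := negBinomSeries l w
  set Z : PowerSeries ℂ := PowerSeries.C z
  set W : PowerSeries ℂ := PowerSeries.C w
  set Y : PowerSeries ℂ := PowerSeries.C x
  set K : PowerSeries ℂ := PowerSeries.C (l : ℂ)
  set T : PowerSeries ℂ := PowerSeries.X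
  have hq : (1 - 2 * Y * T + T * T) = (1 - Z * T) * (1 - W * T) := by
    linear_combination T * h2' - T * T * h1'
  rw [hq]
  linear_combination (1 - Z * T) * A * hw + (1 - W * T) * B * hz - 2 * K * T * A * B * h1'
    + K * A * B * h2'

/-- Comparing coefficients of `t^(k+1)` in the differential equation yields the recurrence that
defines `gegenbauer`. -/
lemma coeff_negBinomSeries_mul_recurrence (l : ℝ) {x z w : ℂ} (h1 : z * w = 1)
    (h2 : z + w = 2 * x) (k : ℕ) :
    ((k : ℂ) + 2) * PowerSeries.coeff (k + 2) (negBinomSeries l z * negBinomSeries l w)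
      = 2 * (k + 1 + l) * x * PowerSeries.coeff (k + 1) (negBinomSeries l z * negBinomSeries l w)
        - (k + 2 * l) * PowerSeries.coeff k (negBinomSeries l z * negBinomSeries l w) := by
  have h := congrArg (PowerSeries.coeff (k + 1)) (derivative_negBinomSeries_mul l h1 h2)
  set G := negBinomSeries l z * negBinomSeries l w
  rw [add_mul, sub_mul, one_mul, mul_assoc, mul_assoc, mul_assoc, sub_mul, map_add, map_sub,
    PowerSeries.coeff_C_mul, PowerSeries.coeff_C_mul, map_sub, PowerSeries.coeff_C_mul,
    coeff_X_mul_derivative, PowerSeries.coeff_succ_X_mul, PowerSeries.coeff_succ_X_mul,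
    coeff_X_mul_derivative, PowerSeries.coeff_derivative] at h
  push_cast at h
  linear_combination h

/-- The generating function of the Gegenbauer polynomials, in factored form. -/
lemma gegenbauer_eval_eq_coeff (l : ℝ) {x : ℝ} {z w : ℂ} (h1 : z * w = 1)
    (h2 : z + w = 2 * x) (k : ℕ) :
    (((gegenbauer l k).eval x : ℝ) : ℂ)
      = PowerSeries.coeff k (negBinomSeries l z * negBinomSeries l w) := by
  induction k using Nat.twoStepInduction with
  | zero =>
    simp [gegenbauer, negBinomSeries, PowerSeries.coeff_mul, negBinomCoeff_zero]
  | one =>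
    have h := negBinomCoeff_succ l 0
    simp only [negBinomCoeff_zero, zero_add, Nat.cast_zero, mul_one, add_zero] at h
    simp [gegenbauer, negBinomSeries, PowerSeries.coeff_mul, negBinomCoeff_zero, h,
      Finset.Nat.antidiagonal_succ]
    linear_combination -(l : ℂ) * h2
  | more k ih ih' =>
    have h := coeff_negBinomSeries_mul_recurrence l h1 h2 k
    rw [← ih, ← ih'] at h
    have hk : (k : ℂ) + 2 ≠ 0 := by exact_mod_cast (by positivity : (k : ℝ) + 2 ≠ 0)
    apply mul_left_cancel₀ hk
    rw [h]
    simp only [gegenbauer, Polynomial.eval_sub, Polynomial.eval_mul, Polynomial.eval_C,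
      Polynomial.eval_X]
    push_cast
    field_simp

lemma gegenbauer_eval_one (l : ℝ) (k : ℕ) :
    (gegenbauer l k).eval 1
      = ∑ p ∈ Finset.HasAntidiagonal.antidiagonal k, negBinomCoeff l p.1 * negBinomCoeff l p.2 := by
  have h := gegenbauer_eval_eq_coeff l (x := 1) (z := 1) (w := 1) (by simp) (by norm_num) k
  rw [PowerSeries.coeff_mul] at h
  simp only [negBinomSeries, PowerSeries.coeff_mk, one_pow, mul_one] at h
  exact_mod_cast h

lemma gegenbauer_eval_one_pos {l : ℝ} (hl : 0 < l) (k : ℕ) : 0 < (gegenbauer l k).eval 1 := by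
  rw [gegenbauer_eval_one]
  exact Finset.sum_pos (fun p _ => mul_pos (negBinomCoeff_pos hl _) (negBinomCoeff_pos hl _))
    ⟨(0, k), by simp⟩

/-- The triangle inequality with `|z| = |w| = 1` leaves the sum of positive coefficients, which is
the case `z = w = 1`. -/
lemma abs_gegenbauer_eval_le {l : ℝ} (hl : 0 < l) (k : ℕ) {x : ℝ} (hx : |x| ≤ 1) :
    |(gegenbauer l k).eval x| ≤ (gegenbauer l k).eval 1 := by
  have hx' := abs_le.1 hx
  set θ := Real.arccos x
  have hθ : Real.cos θ = x := Real.cos_arccos hx'.1 hx'.2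
  set z : ℂ := Complex.exp (θ * Complex.I)
  set w : ℂ := Complex.exp (-θ * Complex.I)
  have h1 : z * w = 1 := by
    rw [← Complex.exp_add]; simp
  have h2 : z + w = 2 * x := by
    rw [← hθ, Complex.ofReal_cos, Complex.two_cos]
  have hz : ‖z‖ = 1 := Complex.norm_exp_ofReal_mul_I θ
  have hw : ‖w‖ = 1 := by
    have := Complex.norm_exp_ofReal_mul_I (-θ)
    rwa [Complex.ofReal_neg] at this
  have h := gegenbauer_eval_eq_coeff l h1 h2 k
  rw [← Real.norm_eq_abs, ← Complex.norm_real, h, PowerSeries.coeff_mul, gegenbauer_eval_one]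
  refine (norm_sum_le _ _).trans (Finset.sum_le_sum fun p _ => le_of_eq ?_)
  simp [negBinomSeries, hz, hw, abs_of_pos (negBinomCoeff_pos hl _)]

lemma gegenbauer_eval_neg (l : ℝ) (k : ℕ) (x : ℝ) :
    (gegenbauer l k).eval (-x) = (-1) ^ k * (gegenbauer l k).eval x := by
  induction k using Nat.twoStepInduction with
  | zero => simp [gegenbauer]
  | one => simp [gegenbauer]
  | more k ih ih' =>
    simp only [gegenbauer, Polynomial.eval_sub, Polynomial.eval_mul, Polynomial.eval_C,
      Polynomial.eval_X, ih, ih']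
    ring

/-! ### Normalized zonal polynomials and the sign probability. -/

lemma abs_normalizedZonal_le_one {d : ℕ} (hd : 1 ≤ d) (k : ℕ) {x : ℝ} (hx : |x| ≤ 1) :
    |normalizedZonal d k x| ≤ 1 := by
  unfold normalizedZonal zonalPoly
  split_ifs with h
  · simpa using Polynomial.Chebyshev.abs_eval_T_real_le_one k hx
  · have hl : (0 : ℝ) < ((d : ℝ) - 1) / 2 := by
      have : (2 : ℝ) ≤ d := by exact_mod_cast (by omega : 2 ≤ d)
      linarith
    have h1 := gegenbauer_eval_one_pos hl k
    rw [abs_div, abs_of_pos h1, div_le_one h1]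
    exact abs_gegenbauer_eval_le hl k hx

lemma normalizedZonal_neg (d : ℕ) {k : ℕ} (hk : Odd k) (x : ℝ) :
    normalizedZonal d k (-x) = -normalizedZonal d k x := by
  unfold normalizedZonal zonalPoly
  split_ifs with h
  · rw [Polynomial.Chebyshev.T_eval_neg, Int.negOnePow_odd _ (by exact_mod_cast hk)]
    simp
  · rw [gegenbauer_eval_neg, hk.neg_one_pow, neg_one_mul, neg_div]

@[fun_prop]
lemma measurable_normalizedZonal (d k : ℕ) : Measurable (normalizedZonal d k) :=
  (Polynomial.continuous _).measurable.div_const _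

lemma plusProb_mem_Icc {d : ℕ} (hd : 1 ≤ d) (k : ℕ) {ρ r : ℝ} (hρ : ρ ∈ Set.Icc (-1 : ℝ) 1)
    (hr : |r| ≤ 1) : plusProb d k ρ r ∈ Set.Icc (0 : ℝ) 1 := by
  have h : |ρ * normalizedZonal d k r| ≤ 1 := by
    rw [abs_mul]
    exact mul_le_one₀ (abs_le.2 hρ) (abs_nonneg _) (abs_normalizedZonal_le_one hd k hr)
  have h' := abs_le.1 h
  constructor <;> unfold plusProb <;> linarith

/-- This is where odd degree enters: the probability of the sign `-1` at `r` is `plusProb` at `-r`.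
-/
lemma plusProb_neg (d : ℕ) {k : ℕ} (hk : Odd k) (ρ r : ℝ) :
    plusProb d k ρ (-r) = 1 - plusProb d k ρ r := by
  unfold plusProb
  rw [normalizedZonal_neg d hk]
  ring

@[fun_prop]
lemma measurable_plusProb (d k : ℕ) (ρ : ℝ) : Measurable (plusProb d k ρ) := by
  unfold plusProb
  fun_prop

end SphericalCardioid

namespace SphericalCardioid

open Metric Module
open scoped ENNReal

/-! ### Tangent-normal coordinates. -/

section tangentNormal

variable {E H : Type*} [NormedAddCommGroup E] [InnerProductSpace ℝ E]
  [NormedAddCommGroup H] [InnerProductSpace ℝ H]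

/-- The point of the unit sphere with coordinate `t` along `u` and direction `L ξ` in the
orthogonal complement. -/
noncomputable def tangentNormal (u : E) (L : H →ₗᵢ[ℝ] E) (t : ℝ) (ξ : H) : E :=
  t • u + √(1 - t ^ 2) • L ξ

lemma inner_tangentNormal {u : E} (hu : ‖u‖ = 1) {L : H →ₗᵢ[ℝ] E}
    (hL : ∀ y, inner ℝ u (L y) = 0) (t : ℝ) (ξ : H) :
    inner ℝ u (tangentNormal u L t ξ) = t := by
  rw [tangentNormal, inner_add_right, inner_smul_right, inner_smul_right, hL,
    real_inner_self_eq_norm_sq, hu]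
  simp

lemma norm_tangentNormal {u : E} (hu : ‖u‖ = 1) {L : H →ₗᵢ[ℝ] E}
    (hL : ∀ y, inner ℝ u (L y) = 0) {t : ℝ} (ht : |t| ≤ 1) {ξ : H} (hξ : ‖ξ‖ = 1) :
    ‖tangentNormal u L t ξ‖ = 1 := by
  have h0 : 0 ≤ 1 - t ^ 2 := by
    have := sq_le_one_iff_abs_le_one t |>.2 ht
    linarith
  have h : ‖tangentNormal u L t ξ‖ ^ 2 = 1 := by
    rw [tangentNormal, norm_add_sq_real, inner_smul_left, inner_smul_right, hL, norm_smul,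
      norm_smul, hu, L.norm_map, hξ, mul_one, mul_one, Real.norm_eq_abs, Real.norm_eq_abs,
      sq_abs, sq_abs, Real.sq_sqrt h0]
    simp
  exact (pow_eq_one_iff_of_nonneg (norm_nonneg _) two_ne_zero).1 h

end tangentNormal

variable {E H : Type*}
  [NormedAddCommGroup E] [InnerProductSpace ℝ E] [FiniteDimensional ℝ E] [MeasurableSpace E]
  [BorelSpace E]
  [NormedAddCommGroup H] [InnerProductSpace ℝ H] [FiniteDimensional ℝ H] [MeasurableSpace H]
  [BorelSpace H]

@[fun_prop]
lemma measurable_tangentNormal {E H : Type*} [NormedAddCommGroup E] [InnerProductSpace ℝ E]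
    [FiniteDimensional ℝ E] [MeasurableSpace E] [BorelSpace E] [NormedAddCommGroup H]
    [InnerProductSpace ℝ H] [MeasurableSpace H] [BorelSpace H] (u : E) (L : H →ₗᵢ[ℝ] E) :
    Measurable fun p : ℝ × H => tangentNormal u L p.1 p.2 := by
  have hL : Measurable L := L.continuous.measurable
  unfold tangentNormal
  fun_prop

/-! ### Polar coordinates and surface integrals. -/

lemma lintegral_polar [Nontrivial E] {G : E → ℝ≥0∞} (hG : Measurable G) :
    ∫⁻ x, G x = ∫⁻ p, G ((p.2 : ℝ) • (p.1 : E))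
      ∂((volume : Measure E).toSphere.prod (Measure.volumeIoiPow (finrank ℝ E - 1))) := by
  have hp := (volume : Measure E).measurePreserving_homeomorphUnitSphereProd
  have hm : Measurable fun p : sphere (0 : E) 1 × Set.Ioi (0 : ℝ) => G ((p.2 : ℝ) • (p.1 : E)) := by
    fun_prop
  rw [← hp.lintegral_comp hm, ← restrict_compl_singleton (μ := (volume : Measure E)) 0,
    ← lintegral_subtype_comap (measurableSet_singleton _).compl]
  rw [restrict_compl_singleton]
  refine lintegral_congr fun x => ?_
  have hx : ‖(x : E)‖ ≠ 0 := norm_ne_zero_iff.2 x.2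
  simp [smul_smul, hx]

lemma lintegral_polar_iterated [Nontrivial E] {G : E → ℝ≥0∞} (hG : Measurable G) :
    ∫⁻ x, G x = ∫⁻ r, ∫⁻ ξ, G ((r : ℝ) • (ξ : E)) ∂(volume : Measure E).toSphere
      ∂(Measure.volumeIoiPow (finrank ℝ E - 1)) := by
  rw [lintegral_polar hG, lintegral_prod_symm' _ (by fun_prop)]

/-- Turns surface integrals into Lebesgue integrals, where isometries and Fubini apply; the factor
`finrank ℝ E` cancels `∫₀¹ r^(n-1) dr = 1/n`. -/
lemma lintegral_toSphere [Nontrivial E] {f : E → ℝ≥0∞} (hf : Measurable f) :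
    ∫⁻ ξ, f (ξ : E) ∂(volume : Measure E).toSphere
      = finrank ℝ E * ∫⁻ x, (ball (0 : E) 1).indicator (fun x => f (‖x‖⁻¹ • x)) x := by
  have hm : Measurable ((ball (0 : E) 1).indicator (fun x => f (‖x‖⁻¹ • x))) :=
    Measurable.indicator (by fun_prop) measurableSet_ball
  have h1 : ∀ (r : Set.Ioi (0 : ℝ)) (ξ : sphere (0 : E) 1),
      (ball (0 : E) 1).indicator (fun x => f (‖x‖⁻¹ • x)) ((r : ℝ) • (ξ : E))
        = (Set.Iio (⟨1, Set.mem_Ioi.2 one_pos⟩ : Set.Ioi (0 : ℝ))).indicator (fun _ => f ξ) r := by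
    intro r ξ
    have hr : (0 : ℝ) < r := r.2
    have hn : ‖(r : ℝ) • (ξ : E)‖ = r := by simp [norm_smul, abs_of_pos hr]
    have hmem : (r : ℝ) • (ξ : E) ∈ ball (0 : E) 1 ↔
        r ∈ Set.Iio (⟨1, Set.mem_Ioi.2 one_pos⟩ : Set.Ioi (0 : ℝ)) := by
      rw [mem_ball_zero_iff, hn, Set.mem_Iio, ← Subtype.coe_lt_coe]
    by_cases h : r ∈ Set.Iio (⟨1, Set.mem_Ioi.2 one_pos⟩ : Set.Ioi (0 : ℝ))
    · rw [Set.indicator_of_mem (hmem.2 h), Set.indicator_of_mem h, hn, smul_smul,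
        inv_mul_cancel₀ hr.ne', one_smul]
    · rw [Set.indicator_of_notMem (mt hmem.1 h), Set.indicator_of_notMem h]
  rw [lintegral_polar hm]
  simp_rw [h1]
  have h2 : ∀ p : sphere (0 : E) 1 × Set.Ioi (0 : ℝ),
      (Set.Iio (⟨1, Set.mem_Ioi.2 one_pos⟩ : Set.Ioi (0 : ℝ))).indicator (fun _ => f p.1) p.2
        = f p.1 * (Set.Iio (⟨1, Set.mem_Ioi.2 one_pos⟩ : Set.Ioi (0 : ℝ))).indicator 1 p.2 := by
    intro p
    by_cases h : p.2 ∈ Set.Iio (⟨1, Set.mem_Ioi.2 one_pos⟩ : Set.Ioi (0 : ℝ)) <;> simp [h]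
  simp_rw [h2]
  rw [lintegral_prod_mul (f := fun ξ : sphere (0 : E) 1 => f ξ)
    (g := (Set.Iio (⟨1, Set.mem_Ioi.2 one_pos⟩ : Set.Ioi (0 : ℝ))).indicator 1) (by fun_prop)
    ((measurable_one.indicator measurableSet_Iio).aemeasurable),
    lintegral_indicator_one measurableSet_Iio, Measure.volumeIoiPow_apply_Iio]
  have hn : 0 < finrank ℝ E := finrank_pos
  have h3 : (finrank ℝ E : ℝ≥0∞) *
      ENNReal.ofReal (1 ^ (finrank ℝ E - 1 + 1) / ((finrank ℝ E - 1 : ℕ) + 1)) = 1 := by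
    rw [← ENNReal.ofReal_natCast, ← ENNReal.ofReal_mul (by positivity), Nat.cast_pred hn]
    simp [hn.ne']
  rw [mul_left_comm, h3, mul_one]

lemma lintegral_toSphere_comp_isometry [Nontrivial E] (Q : E ≃ₗᵢ[ℝ] E) {f : E → ℝ≥0∞}
    (hf : Measurable f) :
    ∫⁻ ξ, f (Q ξ) ∂(volume : Measure E).toSphere
      = ∫⁻ ξ, f (ξ : E) ∂(volume : Measure E).toSphere := by
  have hQ : Measurable Q := Q.continuous.measurable
  rw [lintegral_toSphere hf, lintegral_toSphere (f := fun x => f (Q x)) (hf.comp hQ),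
    ← Q.measurePreserving.lintegral_comp
      (f := (ball (0 : E) 1).indicator (fun x => f (‖x‖⁻¹ • x)))
      (Measurable.indicator (by fun_prop) measurableSet_ball)]
  congr 1
  refine lintegral_congr fun x => ?_
  simp [Set.indicator]

/-- Under Lebesgue measure the direction is uniform and independent of the norm. -/
lemma lintegral_norm_direction [Nontrivial H] {g : ℝ → H → ℝ≥0∞}
    (hg : Measurable (Function.uncurry g)) :
    (volume : Measure H).toSphere Set.univ * ∫⁻ y : H, g ‖y‖ (‖y‖⁻¹ • y)
      = ∫⁻ y : H, ∫⁻ ξ, g ‖y‖ ξ ∂(volume : Measure H).toSphere := by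
  have hm1 : Measurable fun y : H => g ‖y‖ (‖y‖⁻¹ • y) :=
    hg.comp (f := fun y : H => (‖y‖, ‖y‖⁻¹ • y)) (by fun_prop)
  have hm2 : Measurable fun y : H => ∫⁻ ξ, g ‖y‖ ξ ∂(volume : Measure H).toSphere :=
    Measurable.lintegral_prod_right' (f := fun y : H × sphere (0 : H) 1 => g ‖y.1‖ y.2)
      (hg.comp (f := fun p : H × sphere (0 : H) 1 => (‖p.1‖, (p.2 : H))) (by fun_prop))
  have hm3 : Measurable fun r : Set.Ioi (0 : ℝ) =>
      ∫⁻ ξ, g r ξ ∂(volume : Measure H).toSphere :=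
    Measurable.lintegral_prod_right' (f := fun p : Set.Ioi (0 : ℝ) × sphere (0 : H) 1 => g p.1 p.2)
      (hg.comp (f := fun p : Set.Ioi (0 : ℝ) × sphere (0 : H) 1 => ((p.1 : ℝ), (p.2 : H)))
        (by fun_prop))
  have hn : ∀ (r : Set.Ioi (0 : ℝ)) (ξ : sphere (0 : H) 1), ‖(r : ℝ) • (ξ : H)‖ = r := by
    intro r ξ
    simp [norm_smul, abs_of_pos (show (0 : ℝ) < r from r.2)]
  rw [lintegral_polar_iterated hm1, lintegral_polar_iterated hm2,
    ← lintegral_const_mul]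
  · refine lintegral_congr fun r => ?_
    have hr : (r : ℝ) ≠ 0 := ne_of_gt r.2
    simp_rw [hn, smul_smul, inv_mul_cancel₀ hr, one_smul]
    -- At fixed radius the right-hand integrand no longer depends on the polar direction, which
    -- integrates to the total mass.
    rw [lintegral_const, mul_comm]
  · simp_rw [hn, smul_smul]
    have : ∀ r : Set.Ioi (0 : ℝ), ((r : ℝ))⁻¹ * r = 1 := fun r => inv_mul_cancel₀ (ne_of_gt r.2)
    simp_rw [this, one_smul]
    exact hm3

/-! ### Tangent-normal decomposition of the surface measure. -/

/-- Orthogonal decomposition along a unit vector preserves Lebesgue measure. -/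
lemma measurePreserving_smul_add (u : E) (hu : ‖u‖ = 1) (L : H →ₗᵢ[ℝ] E)
    (hL : ∀ y, inner ℝ u (L y) = 0) (hdim : finrank ℝ E = finrank ℝ H + 1) :
    MeasurePreserving (fun p : ℝ × H => p.1 • u + L p.2) := by
  -- The plain product has the sup norm; on the `L²` product the map is an isometry, and `toLp`
  -- preserves volume.
  let Φ : WithLp 2 (ℝ × H) →ₗ[ℝ] E :=
    { toFun := fun p => p.fst • u + L p.snd
      map_add' := fun p q => by simp [add_smul]; abel
      map_smul' := fun c p => by simp [mul_smul] }
  have hΦ : ∀ p, ‖Φ p‖ = ‖p‖ := by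
    intro p
    have h1 : ‖Φ p‖ ^ 2 = ‖p‖ ^ 2 := by
      change ‖p.fst • u + L p.snd‖ ^ 2 = _
      rw [norm_add_sq_real, inner_smul_left, hL, WithLp.prod_norm_sq_eq_of_L2, norm_smul, hu]
      simp
    exact (sq_eq_sq₀ (norm_nonneg _) (norm_nonneg _)).1 h1
  let Ψ : WithLp 2 (ℝ × H) →ₗᵢ[ℝ] E := ⟨Φ, hΦ⟩
  have hfr : finrank ℝ (WithLp 2 (ℝ × H)) = finrank ℝ E := by
    rw [hdim, (WithLp.linearEquiv 2 ℝ (ℝ × H)).finrank_eq, finrank_prod, finrank_self, add_comm]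
  exact (Ψ.toLinearIsometryEquiv hfr).measurePreserving.comp
    (WithLp.volume_preserving_toLp ℝ H)

/-- The tangent-normal decomposition of the surface measure. -/
lemma lintegral_toSphere_tangentNormal [Nontrivial H] {u : E} (hu : ‖u‖ = 1) {L : H →ₗᵢ[ℝ] E}
    (hL : ∀ y, inner ℝ u (L y) = 0) (hdim : finrank ℝ E = finrank ℝ H + 1)
    {f : E → ℝ≥0∞} (hf : Measurable f) :
    ∫⁻ x, (∫⁻ ξ, f (tangentNormal u L (inner ℝ u (x : E)) ξ) ∂(volume : Measure H).toSphere)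
        ∂(volume : Measure E).toSphere
      = (volume : Measure H).toSphere Set.univ * ∫⁻ x, f x ∂(volume : Measure E).toSphere := by
  have : Nontrivial E := ⟨u, 0, fun h => by simp [h] at hu⟩
  have hLm : Measurable L := L.continuous.measurable
  have hmp := measurePreserving_smul_add u hu L hL hdim
  set h : E → ℝ≥0∞ := fun x =>
    ∫⁻ ξ, f (tangentNormal u L (inner ℝ u x) ξ) ∂(volume : Measure H).toSphere with hh
  have hhm : Measurable h :=
    Measurable.lintegral_prod_right'
      (f := fun p : E × sphere (0 : H) 1 => f (tangentNormal u L (inner ℝ u p.1) p.2))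
      (hf.comp ((measurable_tangentNormal u L).comp
        (f := fun p : E × sphere (0 : H) 1 => (inner ℝ u p.1, (p.2 : H))) (by fun_prop)))
  have key : ∀ {F : E → ℝ≥0∞}, Measurable F →
      ∫⁻ x, F x ∂(volume : Measure E).toSphere = finrank ℝ E * ∫⁻ s : ℝ, ∫⁻ y : H,
        (ball (0 : E) 1).indicator (fun x => F (‖x‖⁻¹ • x)) (s • u + L y) := by
    intro F hF
    have hm : Measurable ((ball (0 : E) 1).indicator (fun x => F (‖x‖⁻¹ • x))) :=
      Measurable.indicator (by fun_prop) measurableSet_ball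
    rw [lintegral_toSphere hF, ← hmp.lintegral_comp hm, Measure.volume_eq_prod,
      lintegral_prod (fun p : ℝ × H =>
        (ball (0 : E) 1).indicator (fun x => F (‖x‖⁻¹ • x)) (p.1 • u + L p.2))
        (hm.comp hmp.measurable).aemeasurable]
  rw [key hhm, key hf, mul_left_comm]
  congr 1
  have hm' : Measurable fun s : ℝ => ∫⁻ y : H,
      (ball (0 : E) 1).indicator (fun x => f (‖x‖⁻¹ • x)) (s • u + L y) :=
    Measurable.lintegral_prod_right' (f := fun p : ℝ × H =>
      (ball (0 : E) 1).indicator (fun x => f (‖x‖⁻¹ • x)) (p.1 • u + L p.2))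
      ((Measurable.indicator (by fun_prop) measurableSet_ball).comp hmp.measurable)
  rw [← lintegral_const_mul _ hm']
  refine lintegral_congr fun s => ?_
  have hnorm : ∀ y : H, ‖s • u + L y‖ = √(s ^ 2 + ‖y‖ ^ 2) := by
    intro y
    rw [← Real.sqrt_sq (norm_nonneg (s • u + L y)), norm_add_sq_real, inner_smul_left, hL,
      norm_smul, hu, L.norm_map]
    simp
  -- For fixed `s`, the normalized point depends on `y` only through its norm `r` and direction `ξ`.
  set g : ℝ → H → ℝ≥0∞ := fun r ξ => {r : ℝ | √(s ^ 2 + r ^ 2) < 1}.indicator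
    (fun r => f ((√(s ^ 2 + r ^ 2))⁻¹ • (s • u + r • L ξ))) r with hg
  have hgm : Measurable (Function.uncurry g) := by
    have hs : MeasurableSet {p : ℝ × H | √(s ^ 2 + p.1 ^ 2) < 1} :=
      measurableSet_lt (by fun_prop) (by fun_prop)
    exact Measurable.indicator (f := fun p : ℝ × H =>
      f ((√(s ^ 2 + p.1 ^ 2))⁻¹ • (s • u + p.1 • L p.2))) (by fun_prop) hs
  -- Excluding `y = 0` gives `y` a direction and keeps `s² + ‖y‖²` positive even at `s = 0`.
  have hae : ∀ᵐ y : H, y ≠ 0 := by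
    simp [ae_iff]
  have e1 : ∫⁻ y : H, (ball (0 : E) 1).indicator (fun x => f (‖x‖⁻¹ • x)) (s • u + L y)
      = ∫⁻ y : H, g ‖y‖ (‖y‖⁻¹ • y) := by
    refine lintegral_congr_ae (hae.mono fun y hy => ?_)
    have hy' : ‖y‖ ≠ 0 := norm_ne_zero_iff.2 hy
    simp only [hg, Set.indicator, mem_ball_zero_iff, hnorm, Set.mem_ofPred_eq, map_smul, smul_smul,
      mul_inv_cancel₀ hy', one_smul]
  have e2 : ∫⁻ y : H, (ball (0 : E) 1).indicator (fun x => h (‖x‖⁻¹ • x)) (s • u + L y)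
      = ∫⁻ y : H, ∫⁻ ξ, g ‖y‖ ξ ∂(volume : Measure H).toSphere := by
    refine lintegral_congr_ae (hae.mono fun y hy => ?_)
    have hy' : 0 < ‖y‖ := norm_pos_iff.2 hy
    have hpos : 0 < s ^ 2 + ‖y‖ ^ 2 := by positivity
    have hq : 0 < √(s ^ 2 + ‖y‖ ^ 2) := Real.sqrt_pos.2 hpos
    by_cases hlt : √(s ^ 2 + ‖y‖ ^ 2) < 1
    · simp only [hg, hh, Set.indicator, mem_ball_zero_iff, hnorm, Set.mem_ofPred_eq, if_pos hlt]
      refine lintegral_congr fun ξ => ?_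
      have hi : inner ℝ u ((√(s ^ 2 + ‖y‖ ^ 2))⁻¹ • (s • u + L y)) = (√(s ^ 2 + ‖y‖ ^ 2))⁻¹ * s := by
        rw [inner_smul_right, inner_add_right, inner_smul_right, hL, real_inner_self_eq_norm_sq, hu]
        simp
      -- Normalizing `s u + L y` gives tangential length `‖y‖ / √(s² + ‖y‖²)`, so `h` averages `g`
      -- over the direction alone.
      have hr : √(1 - ((√(s ^ 2 + ‖y‖ ^ 2))⁻¹ * s) ^ 2) = (√(s ^ 2 + ‖y‖ ^ 2))⁻¹ * ‖y‖ := by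
        rw [← Real.sqrt_sq (show 0 ≤ (√(s ^ 2 + ‖y‖ ^ 2))⁻¹ * ‖y‖ by positivity), mul_pow, mul_pow,
          inv_pow, Real.sq_sqrt hpos.le]
        congr 1
        field_simp
        ring
      rw [hi, tangentNormal, hr, smul_add, smul_smul, smul_smul]
    · simp [hg, Set.indicator, hnorm, hlt]
  rw [e1, e2, lintegral_norm_direction hgm]

end SphericalCardioid

namespace SphericalCardioid

open Metric Module
open scoped ENNReal

/-! ### The uniform and cardioid distributions. -/

lemma sphereArea_pos {n : ℕ} (hn : 1 ≤ n) : 0 < sphereArea n := by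
  have hn' : (0 : ℝ) < n := by exact_mod_cast hn
  have := Real.Gamma_pos_of_pos (half_pos hn')
  unfold sphereArea
  positivity

lemma surfaceMeasure_univ {n : ℕ} (hn : 1 ≤ n) :
    surfaceMeasure n Set.univ = ENNReal.ofReal (sphereArea n) := by
  have : Nonempty (Fin n) := ⟨⟨0, hn⟩⟩
  have hn' : (0 : ℝ) < n := by exact_mod_cast hn
  have hΓ := Real.Gamma_pos_of_pos (half_pos hn')
  rw [surfaceMeasure, Measure.toSphere_apply_univ, EuclideanSpace.volume_ball, finrank_euclideanSpace,
    Fintype.card_fin, ENNReal.ofReal_one, one_pow, one_mul, ← ENNReal.ofReal_natCast,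
    ← ENNReal.ofReal_mul hn'.le, sphereArea, Real.Gamma_add_one (half_pos hn').ne',
    Real.sqrt_eq_rpow, ← Real.rpow_natCast, ← Real.rpow_mul Real.pi_pos.le, one_div_mul_eq_div]
  congr 1
  field_simp

lemma lintegral_uniformSphere {n : ℕ} {f : EuclideanSpace ℝ (Fin n) → ℝ≥0∞} (hf : Measurable f) :
    ∫⁻ x, f x ∂(uniformSphere n)
      = ENNReal.ofReal (1 / sphereArea n) * ∫⁻ x, f x ∂(surfaceMeasure n) := by
  rw [uniformSphere, lintegral_withDensity_eq_lintegral_mul _ measurable_const (by fun_prop)]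
  simp only [Pi.mul_apply]
  rw [lintegral_const_mul _ (by fun_prop)]

lemma inv_sphereArea_mul_surfaceMeasure_univ {n : ℕ} (hn : 1 ≤ n) :
    ENNReal.ofReal (1 / sphereArea n) * surfaceMeasure n Set.univ = 1 := by
  have h := sphereArea_pos hn
  rw [surfaceMeasure_univ hn, ← ENNReal.ofReal_mul (by positivity), one_div,
    inv_mul_cancel₀ h.ne', ENNReal.ofReal_one]

lemma isProbabilityMeasure_uniformSphere {n : ℕ} (hn : 1 ≤ n) :
    IsProbabilityMeasure (uniformSphere n) := by
  constructor
  rw [← lintegral_one, lintegral_uniformSphere (f := fun _ => 1) measurable_const, lintegral_one,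
    inv_sphereArea_mul_surfaceMeasure_univ hn]

lemma lintegral_uniformSphere_comp_isometry {n : ℕ}
    (Q : EuclideanSpace ℝ (Fin (n + 1)) ≃ₗᵢ[ℝ] EuclideanSpace ℝ (Fin (n + 1)))
    {f : EuclideanSpace ℝ (Fin (n + 1)) → ℝ≥0∞} (hf : Measurable f) :
    ∫⁻ x, f (Q x) ∂(uniformSphere (n + 1)) = ∫⁻ x, f x ∂(uniformSphere (n + 1)) := by
  have hQ : Measurable Q := Q.continuous.measurable
  rw [lintegral_uniformSphere hf, lintegral_uniformSphere (f := fun x => f (Q x)) (hf.comp hQ),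
    surfaceMeasure, lintegral_toSphere_comp_isometry Q hf]

lemma lintegral_uniformSphere_inner_neg {n : ℕ} (u : EuclideanSpace ℝ (Fin (n + 1)))
    {φ : ℝ → ℝ≥0∞} (hφ : Measurable φ) :
    ∫⁻ x, φ (-inner ℝ u (x : EuclideanSpace ℝ (Fin (n + 1)))) ∂(uniformSphere (n + 1))
      = ∫⁻ x, φ (inner ℝ u (x : EuclideanSpace ℝ (Fin (n + 1)))) ∂(uniformSphere (n + 1)) := by
  have h := lintegral_uniformSphere_comp_isometry (LinearIsometryEquiv.neg ℝ)
    (f := fun x : EuclideanSpace ℝ (Fin (n + 1)) => φ (inner ℝ u x)) (by fun_prop)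
  simpa using h

/-- The one-dimensional marginals of the uniform distribution agree in all directions. -/
lemma lintegral_uniformSphere_inner_congr {n : ℕ} {u v : EuclideanSpace ℝ (Fin (n + 1))}
    (huv : ‖u‖ = ‖v‖) {φ : ℝ → ℝ≥0∞} (hφ : Measurable φ) :
    ∫⁻ x, φ (inner ℝ u (x : EuclideanSpace ℝ (Fin (n + 1)))) ∂(uniformSphere (n + 1))
      = ∫⁻ x, φ (inner ℝ v (x : EuclideanSpace ℝ (Fin (n + 1)))) ∂(uniformSphere (n + 1)) := by
  set Q := (ℝ ∙ (u - v))ᗮ.reflection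
  have hQ : Q u = v := Submodule.reflection_sub huv
  rw [← lintegral_uniformSphere_comp_isometry Q
    (f := fun x : EuclideanSpace ℝ (Fin (n + 1)) => φ (inner ℝ v x)) (by fun_prop)]
  simp_rw [← hQ, Q.inner_map_map]

/-- The tangent-normal decomposition of the uniform distribution. -/
lemma lintegral_uniformSphere_tangentNormal {d : ℕ} (hd : 1 ≤ d)
    {u : EuclideanSpace ℝ (Fin (d + 1))} (hu : ‖u‖ = 1)
    {L : EuclideanSpace ℝ (Fin d) →ₗᵢ[ℝ] EuclideanSpace ℝ (Fin (d + 1))}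
    (hL : ∀ y, inner ℝ u (L y) = 0) {f : EuclideanSpace ℝ (Fin (d + 1)) → ℝ≥0∞}
    (hf : Measurable f) :
    ∫⁻ x, (∫⁻ ξ, f (tangentNormal u L (inner ℝ u (x : EuclideanSpace ℝ (Fin (d + 1)))) ξ)
        ∂(uniformSphere d)) ∂(uniformSphere (d + 1))
      = ∫⁻ x, f x ∂(uniformSphere (d + 1)) := by
  have : Nonempty (Fin d) := ⟨⟨0, hd⟩⟩
  have h1 : ∀ t : ℝ, ∫⁻ ξ, f (tangentNormal u L t ξ) ∂(uniformSphere d)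
      = ENNReal.ofReal (1 / sphereArea d) *
        ∫⁻ ξ, f (tangentNormal u L t ξ) ∂(surfaceMeasure d) := fun t =>
    lintegral_uniformSphere (f := fun ξ => f (tangentNormal u L t ξ))
      (hf.comp ((measurable_tangentNormal u L).comp measurable_prodMk_left))
  have hm : Measurable fun x : EuclideanSpace ℝ (Fin (d + 1)) =>
      ∫⁻ ξ, f (tangentNormal u L (inner ℝ u x) ξ) ∂(surfaceMeasure d) := by
    unfold surfaceMeasure
    exact Measurable.lintegral_prod_right'
      (f := fun p : EuclideanSpace ℝ (Fin (d + 1)) × UnitSphere d =>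
        f (tangentNormal u L (inner ℝ u p.1) p.2))
      (hf.comp ((measurable_tangentNormal u L).comp
        (f := fun p : EuclideanSpace ℝ (Fin (d + 1)) × UnitSphere d =>
          (inner ℝ u p.1, (p.2 : EuclideanSpace ℝ (Fin d)))) (by fun_prop)))
  simp_rw [h1]
  rw [lintegral_uniformSphere (f := fun x => ENNReal.ofReal (1 / sphereArea d) *
      ∫⁻ ξ, f (tangentNormal u L (inner ℝ u x) ξ) ∂(surfaceMeasure d)) (hm.const_mul _),
    lintegral_const_mul _ (f := fun x : UnitSphere (d + 1) =>
      ∫⁻ ξ, f (tangentNormal u L (inner ℝ u (x : EuclideanSpace ℝ (Fin (d + 1)))) ξ)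
        ∂(surfaceMeasure d)) (hm.comp measurable_subtype_coe), lintegral_uniformSphere hf]
  congr 1
  unfold surfaceMeasure
  rw [lintegral_toSphere_tangentNormal hu hL (by simp) hf, ← mul_assoc]
  change ENNReal.ofReal (1 / sphereArea d) * surfaceMeasure d Set.univ * _ = _
  rw [inv_sphereArea_mul_surfaceMeasure_univ hd, one_mul]

/-- Valid for every `ρ`: splitting off `1 / sphereArea` needs only that this factor be nonnegative.
-/
lemma lintegral_cardioid {d k : ℕ} (μ : UnitSphere (d + 1)) (ρ : ℝ)
    {f : EuclideanSpace ℝ (Fin (d + 1)) → ℝ≥0∞} (hf : Measurable f) :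
    ∫⁻ x, f x ∂(cardioid d k μ ρ)
      = ∫⁻ x, ENNReal.ofReal (1 + ρ * normalizedZonal d k
          (inner ℝ (μ : EuclideanSpace ℝ (Fin (d + 1))) (x : EuclideanSpace ℝ (Fin (d + 1))))) *
          f x ∂(uniformSphere (d + 1)) := by
  have hm : Measurable (cardioidDensity d k μ ρ) := by
    unfold cardioidDensity
    fun_prop
  rw [cardioid, lintegral_withDensity_eq_lintegral_mul _ (by fun_prop) (by fun_prop),
    lintegral_uniformSphere (f := fun x => ENNReal.ofReal (1 + ρ * normalizedZonal d k
      (inner ℝ (μ : EuclideanSpace ℝ (Fin (d + 1))) x)) * f x) (by fun_prop),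
    ← lintegral_const_mul _ (by fun_prop)]
  refine lintegral_congr fun x => ?_
  have h := sphereArea_pos (n := d + 1) (by omega)
  rw [Pi.mul_apply, cardioidDensity, ENNReal.ofReal_mul (by positivity), real_inner_comm, mul_assoc]

/-! ### Integrals weighted by a conditional probability. -/

section conditional

variable {Ω : Type*} [MeasurableSpace Ω] {P : Measure Ω} [IsProbabilityMeasure P]
  {R : Ω → ℝ} {A : Set Ω} {q : ℝ → ℝ}

/-- If `P (A | R) = q (R)`, then integrals over `A` of functions of `R` have weight `q (R)`. -/
lemma setLIntegral_eq_of_condProb (hR : Measurable R) (hA : MeasurableSet A) (hq : Measurable q)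
    (hq0 : ∀ ω, 0 ≤ q (R ω))
    (h : P⟦A | MeasurableSpace.comap R inferInstance⟧ =ᵐ[P] fun ω => q (R ω))
    {φ : ℝ → ℝ≥0∞} (hφ : Measurable φ) :
    ∫⁻ ω in A, φ (R ω) ∂P = ∫⁻ ω, ENNReal.ofReal (q (R ω)) * φ (R ω) ∂P := by
  have hle := hR.comap_le
  have hint : Integrable (fun ω => q (R ω)) P := integrable_condExp.congr h
  -- The events `R ⁻¹' s` are exactly those on which the conditional expectation is characterized.
  have key : (P.restrict A).map R
      = (P.withDensity fun ω => ENNReal.ofReal (q (R ω))).map R := by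
    ext s hs
    have hRs : MeasurableSet (R ⁻¹' s) := hR hs
    rw [Measure.map_apply hR hs, Measure.map_apply hR hs, withDensity_apply _ hRs,
      Measure.restrict_apply hRs, ← ofReal_integral_eq_lintegral_ofReal hint.integrableOn
        (ae_of_all _ hq0),
      ← setIntegral_congr_ae hRs (h.mono fun ω hω _ => hω),
      setIntegral_condExp hle ((integrable_const 1).indicator hA) ⟨s, hs, rfl⟩,
      setIntegral_indicator hA]
    simp
  rw [← lintegral_map hφ hR, key, lintegral_map hφ hR,
    lintegral_withDensity_eq_lintegral_mul _ (by fun_prop) (by fun_prop)]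
  rfl

lemma condProb_compl (hR : Measurable R) (hA : MeasurableSet A)
    (h : P⟦A | MeasurableSpace.comap R inferInstance⟧ =ᵐ[P] fun ω => q (R ω)) :
    P⟦Aᶜ | MeasurableSpace.comap R inferInstance⟧ =ᵐ[P] fun ω => 1 - q (R ω) := by
  have hle := hR.comap_le
  have h1 : (Aᶜ.indicator fun _ => (1 : ℝ)) = (fun _ => (1 : ℝ)) - A.indicator fun _ => (1 : ℝ) := by
    ext ω
    by_cases hω : ω ∈ A <;> simp [hω]
  have h2 := condExp_sub (m := MeasurableSpace.comap R inferInstance) (μ := P)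
    (integrable_const (1 : ℝ)) ((integrable_const (1 : ℝ)).indicator hA)
  rw [h1]
  filter_upwards [h2, h] with ω h2 h
  rw [h2, Pi.sub_apply, condExp_const hle, h]

end conditional

/-! ### The law of the signed radius. -/

lemma radius_mem {d : ℕ} {Ω : Type*} (U : Ω → UnitSphere (d + 1)) (ω : Ω) :
    radius U ω ∈ Set.Icc (0 : ℝ) 1 := by
  refine ⟨abs_nonneg _, (abs_real_inner_le_norm _ _).trans ?_⟩
  simp

lemma measurable_radius {d : ℕ} {Ω : Type*} [MeasurableSpace Ω] {U : Ω → UnitSphere (d + 1)}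
    (hU : Measurable U) : Measurable (radius U) := by
  unfold radius
  simp_rw [← Real.norm_eq_abs]
  fun_prop

/-- The law of `T = S R` is the projection of the spherical cardioid distribution. -/
lemma lintegral_signed_radius {Ω : Type*} [MeasurableSpace Ω] {P : Measure Ω}
    [IsProbabilityMeasure P] {d k : ℕ} (hd : 1 ≤ d) (hk : Odd k) {ρ : ℝ}
    (hρ : ρ ∈ Set.Icc (-1 : ℝ) 1) {U : Ω → UnitSphere (d + 1)} {S : Ω → ℝ} {Ξ : Ω → UnitSphere d}
    (h : IsRun P d k ρ U S Ξ) (μ : UnitSphere (d + 1)) {φ : ℝ → ℝ≥0∞} (hφ : Measurable φ) :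
    ∫⁻ ω, φ (S ω * radius U ω) ∂P
      = ∫⁻ x, ENNReal.ofReal (1 + ρ * normalizedZonal d k
          (inner ℝ (μ : EuclideanSpace ℝ (Fin (d + 1))) (x : EuclideanSpace ℝ (Fin (d + 1))))) *
          φ (inner ℝ (μ : EuclideanSpace ℝ (Fin (d + 1))) (x : EuclideanSpace ℝ (Fin (d + 1))))
          ∂(uniformSphere (d + 1)) := by
  have hR := measurable_radius h.measurable_U
  set A : Set Ω := S ⁻¹' {1}
  have hA : MeasurableSet A := h.measurable_S (measurableSet_singleton 1)
  have habs : ∀ ω, |radius U ω| ≤ 1 := fun ω => by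
    rw [abs_of_nonneg (radius_mem U ω).1]; exact (radius_mem U ω).2
  have hp := fun ω => plusProb_mem_Icc hd k hρ (habs ω)
  set ψ : ℝ → ℝ≥0∞ := fun t => ENNReal.ofReal (plusProb d k ρ t) * φ t with hψ
  have hψm : Measurable ψ := by fun_prop
  have e1 : ∫⁻ ω in A, φ (S ω * radius U ω) ∂P = ∫⁻ ω, ψ (radius U ω) ∂P := by
    rw [← setLIntegral_eq_of_condProb hR hA (measurable_plusProb d k ρ) (fun ω => (hp ω).1)
      h.condProb_S hφ]
    refine setLIntegral_congr_fun hA fun ω hω => ?_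
    have : S ω = 1 := hω
    simp only [this, one_mul]
  have e2 : ∫⁻ ω in Aᶜ, φ (S ω * radius U ω) ∂P = ∫⁻ ω, ψ (-radius U ω) ∂P := by
    have h' := setLIntegral_eq_of_condProb (φ := fun t => φ (-t)) (q := fun t => 1 - plusProb d k ρ t)
      hR hA.compl (by fun_prop) (fun ω => sub_nonneg.2 (hp ω).2)
      (condProb_compl hR hA h.condProb_S) (by fun_prop)
    simp only [hψ, plusProb_neg d hk]
    rw [← h']
    refine setLIntegral_congr_fun hA.compl fun ω hω => ?_
    have : S ω = -1 := (h.sign_S ω).resolve_left hω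
    simp only [this, neg_one_mul]
  set e : EuclideanSpace ℝ (Fin (d + 1)) := EuclideanSpace.single 0 1
  have he : ‖(μ : EuclideanSpace ℝ (Fin (d + 1)))‖ = ‖e‖ := by simp [e]
  -- The symmetric sum does not see the absolute value, so `R` may be replaced by `Uᵀe₁`.
  have e3 : ∀ ω, ψ (radius U ω) + ψ (-radius U ω)
      = ψ (inner ℝ e (U ω : EuclideanSpace ℝ (Fin (d + 1))))
        + ψ (-inner ℝ e (U ω : EuclideanSpace ℝ (Fin (d + 1)))) := by
    intro ω
    rw [radius, real_inner_comm]
    rcases abs_choice (inner ℝ e (U ω : EuclideanSpace ℝ (Fin (d + 1)))) with h | h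
    · rw [h]
    · rw [h, neg_neg, add_comm]
  rw [← lintegral_add_compl _ hA, e1, e2, ← lintegral_add_left (by fun_prop)]
  simp_rw [e3]
  have e4 := lintegral_map (μ := P) (g := U)
    (f := fun x : UnitSphere (d + 1) => ψ (inner ℝ e (x : EuclideanSpace ℝ (Fin (d + 1))))
      + ψ (-inner ℝ e (x : EuclideanSpace ℝ (Fin (d + 1))))) (by fun_prop) h.measurable_U
  -- Symmetry makes the two halves equal, and rotation invariance replaces `e₁` by `μ`; twice
  -- `plusProb` is the density.
  rw [← e4, h.law_U.map_eq, lintegral_add_left (by fun_prop), lintegral_uniformSphere_inner_neg e hψm,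
    ← lintegral_uniformSphere_inner_congr he hψm, ← lintegral_add_left (by fun_prop)]
  refine lintegral_congr fun x => ?_
  rw [hψ, ← add_mul]
  congr 1
  have hx : |inner ℝ (μ : EuclideanSpace ℝ (Fin (d + 1))) (x : EuclideanSpace ℝ (Fin (d + 1)))| ≤ 1 :=
    (abs_real_inner_le_norm _ _).trans (by simp)
  have h0 := (plusProb_mem_Icc hd k hρ hx).1
  rw [← ENNReal.ofReal_add h0 h0, plusProb, add_halves]

/-! ### The frame isometry and the law of the output. -/

/-- The isometric embedding given by a matrix with orthonormal columns. -/
noncomputable def frameIsometry {d : ℕ} {B : Matrix (Fin (d + 1)) (Fin d) ℝ} (hB : Bᵀ * B = 1) :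
    EuclideanSpace ℝ (Fin d) →ₗᵢ[ℝ] EuclideanSpace ℝ (Fin (d + 1)) where
  toLinearMap := Matrix.toEuclideanLin B
  norm_map' := fun y => by
    have h : ‖Matrix.toEuclideanLin B y‖ ^ 2 = ‖y‖ ^ 2 := by
      rw [← real_inner_self_eq_norm_sq, ← real_inner_self_eq_norm_sq,
        EuclideanSpace.inner_eq_star_dotProduct, EuclideanSpace.inner_eq_star_dotProduct]
      simp only [star_trivial, Matrix.toEuclideanLin, Matrix.ofLp_toLpLin, Matrix.toLin'_apply]
      rw [Matrix.dotProduct_mulVec, ← Matrix.mulVec_transpose, Matrix.mulVec_mulVec, hB,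
        Matrix.one_mulVec]
    exact (sq_eq_sq₀ (norm_nonneg _) (norm_nonneg _)).1 h

lemma inner_frameIsometry {d : ℕ} {μ : UnitSphere (d + 1)} {B : Matrix (Fin (d + 1)) (Fin d) ℝ}
    (hB : IsTangentFrame μ B) (y : EuclideanSpace ℝ (Fin d)) :
    inner ℝ (μ : EuclideanSpace ℝ (Fin (d + 1))) (frameIsometry hB.1 y) = 0 := by
  change inner ℝ (μ : EuclideanSpace ℝ (Fin (d + 1))) (Matrix.toEuclideanLin B y) = 0
  rw [EuclideanSpace.inner_eq_star_dotProduct]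
  simp only [star_trivial, Matrix.toEuclideanLin, Matrix.ofLp_toLpLin, Matrix.toLin'_apply]
  rw [dotProduct_comm, Matrix.dotProduct_mulVec, hB.2, zero_dotProduct]

lemma output_eq_tangentNormal {d : ℕ} {Ω : Type*} {μ : UnitSphere (d + 1)}
    {B : Matrix (Fin (d + 1)) (Fin d) ℝ} (hB : IsTangentFrame μ B) (U : Ω → UnitSphere (d + 1))
    (S : Ω → ℝ) (Ξ : Ω → UnitSphere d) (ω : Ω) :
    output μ B U S Ξ ω = tangentNormal (μ : EuclideanSpace ℝ (Fin (d + 1))) (frameIsometry hB.1)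
      (S ω * radius U ω) (Ξ ω) :=
  rfl

end SphericalCardioid

theorem proposition3 (d k : ℕ) (hd : 1 ≤ d) (hk : Odd k) (ρ : ℝ) (hρ : ρ ∈ Set.Icc (-1 : ℝ) 1)
    (μ : SphericalCardioid.UnitSphere (d + 1)) (B : Matrix (Fin (d + 1)) (Fin d) ℝ)
    (hB : SphericalCardioid.IsTangentFrame μ B) :
    (∀ r ∈ Set.Icc (0 : ℝ) 1, SphericalCardioid.plusProb d k ρ r ∈ Set.Icc (0 : ℝ) 1) ∧
    ∀ {Ω : Type*} [MeasurableSpace Ω] (P : Measure Ω) [IsProbabilityMeasure P]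
      (U : Ω → SphericalCardioid.UnitSphere (d + 1)) (S : Ω → ℝ)
      (Ξ : Ω → SphericalCardioid.UnitSphere d),
      SphericalCardioid.IsRun P d k ρ U S Ξ →
      (∀ ω, ‖SphericalCardioid.output μ B U S Ξ ω‖ = 1) ∧
      HasLaw (SphericalCardioid.output μ B U S Ξ)
        ((SphericalCardioid.cardioid d k μ ρ).map Subtype.val) P := by
  open SphericalCardioid in
  refine ⟨fun r hr => plusProb_mem_Icc hd k hρ (by rw [abs_of_nonneg hr.1]; exact hr.2), ?_⟩
  intro Ω _ P _ U S Ξ h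
  have hu : ‖(μ : EuclideanSpace ℝ (Fin (d + 1)))‖ = 1 := by simp
  have hL := inner_frameIsometry hB
  set L := frameIsometry hB.1
  have hT : Measurable fun ω => S ω * radius U ω :=
    h.measurable_S.mul (measurable_radius h.measurable_U)
  have hF := measurable_tangentNormal (μ : EuclideanSpace ℝ (Fin (d + 1))) L
  have hF' : Measurable fun p : ℝ × UnitSphere d =>
      tangentNormal (μ : EuclideanSpace ℝ (Fin (d + 1))) L p.1 (p.2 : EuclideanSpace ℝ (Fin d)) :=
    hF.comp (f := fun p : ℝ × UnitSphere d => (p.1, (p.2 : EuclideanSpace ℝ (Fin d))))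
      (by fun_prop)
  have hX : Measurable (output μ B U S Ξ) := hF'.comp (hT.prodMk h.measurable_Ξ)
  refine ⟨fun ω => ?_, hX.aemeasurable, ?_⟩
  · rw [output_eq_tangentNormal hB]
    refine norm_tangentNormal hu hL ?_ (by simp)
    have hr := radius_mem U ω
    rcases h.sign_S ω with hs | hs <;> simp [hs, abs_of_nonneg hr.1, hr.2]
  have := isProbabilityMeasure_uniformSphere hd
  have hind : IndepFun (fun ω => S ω * radius U ω) Ξ P :=
    h.indep.comp (φ := fun p : ℝ × ℝ => p.2 * p.1) (by fun_prop) measurable_id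
  have hjoint := (indepFun_iff_map_prod_eq_prod_map_map hT.aemeasurable
    h.measurable_Ξ.aemeasurable).1 hind
  rw [h.law_Ξ.map_eq] at hjoint
  refine Measure.ext_of_lintegral _ fun f hf => ?_
  rw [lintegral_map hf hX, lintegral_map hf measurable_subtype_coe, lintegral_cardioid μ ρ hf]
  set f' : EuclideanSpace ℝ (Fin (d + 1)) → ENNReal := fun x =>
    ENNReal.ofReal (1 + ρ * normalizedZonal d k
      (inner ℝ (μ : EuclideanSpace ℝ (Fin (d + 1))) x)) * f x with hf'
  have hf'm : Measurable f' := by fun_prop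
  -- By independence of `T` and `Ξ`, averaging over `Ξ` first leaves an integral in `T` alone.
  set φ : ℝ → ENNReal := fun t => ∫⁻ ξ, f (tangentNormal (μ : EuclideanSpace ℝ (Fin (d + 1))) L t
    (ξ : EuclideanSpace ℝ (Fin d))) ∂(uniformSphere d) with hφ
  have hφm : Measurable φ := Measurable.lintegral_prod_right' (hf.comp hF')
  calc ∫⁻ ω, f (output μ B U S Ξ ω) ∂P
      = ∫⁻ p, f (tangentNormal (μ : EuclideanSpace ℝ (Fin (d + 1))) L p.1
          (p.2 : EuclideanSpace ℝ (Fin d)))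
          ∂(P.map fun ω => (S ω * radius U ω, Ξ ω)) :=
        (lintegral_map (hf.comp hF') (hT.prodMk h.measurable_Ξ)).symm
    _ = ∫⁻ ω, φ (S ω * radius U ω) ∂P := by
        rw [hjoint, ← lintegral_map hφm hT]
        exact lintegral_prod _ (hf.comp hF').aemeasurable
    _ = _ := lintegral_signed_radius hd hk hρ h μ hφm
    _ = _ := by
        rw [← lintegral_uniformSphere_tangentNormal hd hu hL hf'm]
        refine lintegral_congr fun x => ?_
        -- Tangent-normal points keep their `μ`-coordinate, so the density is constant in `ξ` and
        -- leaves the inner integral.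
        simp only [hf', inner_tangentNormal hu hL]
        rw [lintegral_const_mul]
        exact hf.comp (hF'.comp measurable_prodMk_left)
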